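/- Let $b\ge 1$ and $n\ge 1$ be integers. For $1\le i\le b$ the card $C_i$ induces the permutation $\pi_{C_i}$ of the levels $\{1,\dots,b\}$ that sends $1$ to $i$, sends $j$ to $j-1$ for $2\le j\le i$, and fixes every $j>i$. A juggling card sequence with $b$ balls and $n$ cards is a sequence $A=C_{i_1}C_{i_2}\cdots C_{i_n}$ with $i_1,\dots,i_n\in\{1,\dots,b\}$; applying the cards from left to right gives the permutation $\pi_A$ (a ball starting on level $j$ ends on level $\pi_A(j)$), and the number of crossings of $A$ is $Cr(A)=\sum_{k=1}^n (i_k-1)$. Call $A$ a minimal crossing juggling card sequence if it uses the card $C_b$ (that is, $i_k=b$ for some $k$), $\pi_A=\mathrm{id}$, and $Cr(A)=b(b-1)$. Theorem. The number of minimal crossing juggling card sequences with $b$ balls and $n$ cards is \[ f(n,b)=\frac1b\binom{n-1}{b-1}\binom{n}{b-1}=\frac1n\binom{n}{b}\binom{n}{b-1}, \] the Narayana numbers. -/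

import Mathlib

/-- The permutation of the `b` levels induced by a card.  Levels are indexed from `0`, so the level
numbered `j` in the usual count is `j - 1 : Fin b`, and `c : Fin b` stands for the card `C_{c+1}`,
which throws the bottom ball to level `c` and moves the levels `1, …, c` down by one. -/
def cardPerm {b : ℕ} (c : Fin b) : Equiv.Perm (Fin b) :=
  (Fin.cycleRange c).symm

/-- The tracks of a card: the bottom level goes to level `c`, each level `j` with `0 < j ≤ c` goes to
`j - 1`, and each level `j > c` stays. -/
theorem cardPerm_val {b : ℕ} (c j : Fin b) :
    (cardPerm c j : ℕ) = if (j : ℕ) = 0 then (c : ℕ) else if j ≤ c then (j : ℕ) - 1 else (j : ℕ) := by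
  unfold cardPerm
  obtain ⟨i, rfl⟩ := (Fin.cycleRange c).surjective j
  rw [Equiv.symm_apply_apply]
  rcases lt_trichotomy i c with h | h | h
  · have h1 := Fin.coe_cycleRange_of_lt h
    have h2 : Fin.cycleRange c i ≤ c := by
      rw [Fin.le_def, h1]; exact h
    simp [h1, h2]
  · subst h
    have h1 := Fin.coe_cycleRange_of_le (le_refl i)
    simp at h1
    simp [h1]
  · have h1 := Fin.cycleRange_of_gt h
    have h2 : (i : ℕ) ≠ 0 := by
      have := Fin.lt_def.mp h
      omega
    simp [h1, h2, not_le.mpr h]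

/-- A juggling card sequence with `b` balls and `n` cards: the card in position `k` is `C_{A k + 1}`,
one of `C_1, …, C_b`. -/
abbrev JugglingCardSequence (b n : ℕ) : Type := Fin n → Fin b

namespace JugglingCardSequence

variable {b n : ℕ}

/-- The final change of the ordering: a ball starting on level `i` ends on level `A.perm i`.  The
cards act from left to right; products in `Equiv.Perm` act from right to left, hence the reversal. -/
def perm (A : JugglingCardSequence b n) : Equiv.Perm (Fin b) :=
  (List.ofFn fun k => cardPerm (A k)).reverse.prod

/-- The total number of crossings: the card `C_i` has `i - 1` of them. -/
def crossings (A : JugglingCardSequence b n) : ℕ :=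
  ∑ k, (A k : ℕ)

/-- The sequence contains the card `C_i`. -/
def UsesCard (A : JugglingCardSequence b n) (i : ℕ) : Prop :=
  ∃ k, (A k : ℕ) + 1 = i

/-- A minimal crossing juggling card sequence with `b` balls. -/
structure IsMinimalCrossing (A : JugglingCardSequence b n) : Prop where
  usesCard_top : A.UsesCard b
  perm_eq_id : A.perm = 1
  crossings_eq : A.crossings = b * (b - 1)

end JugglingCardSequence

/-! Name each ball by its final level and record the balls thrown, in order. This word determines
the cards (`thrown_injective`). Read backwards in time, every throw moves a ball to the front, so
the word yields the initial order (`precedes_thrown_iff`) and the number of times each ball is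
thrown over each other one (`sum_cards_eq`). If the permutation is the identity, two balls are
thrown over each other equally often. The top card forces every ball to be thrown, and then for `x <
y` the ball `y` goes over `x` at least once. This gives at least b(b-1) crossings, with equality iff
each pair crosses exactly once each way (`sum_overtakes_eq_iff`). In the word, the letters `x < y`
then form the pattern x…x y…y x…x, where the last block may be empty: the words are the noncrossing
partitions of the n positions into b blocks, numbered by first occurrence. These words are built
letter by letter. The next letter is the smallest unused one or an open old one, and reusing an open
letter closes all larger ones. Only the number of open letters matters (`natCard_isCompletion`), and
the resulting recursion has a closed form (`completionCount_succ_right`). -/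

namespace JugglingCardSequence

/-! ### The move-to-front order of a word -/

section Words

variable {α : Type*} [LinearOrder α]

/-- `Precedes x y w` says that `x` is in front of `y` in the list obtained from the increasing list
of all letters by moving the letters of `w` to the front one after the other, last letter first. -/
def Precedes (x y : α) : List α → Prop
  | [] => x < y
  | z :: w => x ≠ y ∧ (z = x ∨ (z ≠ y ∧ Precedes x y w))

open Classical in
/-- The number of times that `x` is moved past `y` when the letters of `w` are moved to the front,
last letter first. -/
noncomputable def overtakes (x y : α) : List α → ℕ
  | [] => 0
  | z :: w => overtakes x y w + if z = x ∧ Precedes y x w then 1 else 0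

theorem not_precedes_self (x : α) (w : List α) : ¬ Precedes x x w := by
  cases w <;> simp [Precedes]

theorem not_precedes_iff {x y : α} (h : x ≠ y) (w : List α) :
    ¬ Precedes x y w ↔ Precedes y x w := by
  induction w with
  | nil => simpa [Precedes] using ⟨fun h' => lt_of_le_of_ne h' h.symm, le_of_lt⟩
  | cons z w ih =>
    by_cases hx : z = x
    · subst hx; simp [Precedes, h]
    · by_cases hy : z = y
      · subst hy; simp [Precedes, h, h.symm]
      · simp [Precedes, h, h.symm, hx, hy, ih]

-- Passes between two letters alternate, and `y` starts behind `x`; so `y` has made one pass more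
-- exactly when it ends in front.
open Classical in
theorem overtakes_swap {x y : α} (h : x < y) (w : List α) :
    overtakes y x w = overtakes x y w + if Precedes y x w then 1 else 0 := by
  induction w with
  | nil => simp [overtakes, Precedes, h.not_gt]
  | cons z w ih =>
    have hn := not_precedes_iff h.ne w
    by_cases hx : z = x
    · subst hx
      simp [overtakes, Precedes, h.ne, h.ne', ih]
    · by_cases hy : z = y
      · subst hy
        by_cases hp : Precedes x z w
        · have := (not_precedes_iff h.ne' w).mpr hp
          simp [overtakes, Precedes, h.ne', ih, hp, this]
        · have := hn.mp hp
          simp [overtakes, Precedes, h.ne', ih, hp, this]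
      · simp [overtakes, Precedes, h.ne', hx, hy, ih]

theorem precedes_of_lt_of_notMem {x y : α} (h : x < y) {w : List α} (hy : y ∉ w) :
    Precedes x y w := by
  induction w with
  | nil => exact h
  | cons z w ih =>
    simp only [List.mem_cons, not_or] at hy
    exact ⟨h.ne, Or.inr ⟨Ne.symm hy.1, ih hy.2⟩⟩

theorem precedes_of_mem_of_notMem {x y : α} {w : List α} (hy : y ∈ w) (hx : x ∉ w) :
    Precedes y x w := by
  induction w with
  | nil => simp at hy
  | cons z w ih =>
    have hxy : y ≠ x := fun h => hx (h ▸ hy)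
    simp only [List.mem_cons, not_or] at hx hy
    refine ⟨hxy, ?_⟩
    rcases hy with rfl | hy
    · exact Or.inl rfl
    · exact Or.inr ⟨Ne.symm hx.1, ih hy hx.2⟩

theorem overtakes_of_notMem {x : α} (y : α) {w : List α} (hx : x ∉ w) : overtakes x y w = 0 := by
  induction w with
  | nil => rfl
  | cons z w ih =>
    simp only [List.mem_cons, not_or] at hx
    simp [overtakes, ih hx.2, Ne.symm hx.1]

/-- At the last occurrence of `y` in `w`, the first one to be moved, `x` is still in front. -/
theorem one_le_overtakes {x y : α} (h : x < y) {w : List α} (hy : y ∈ w) :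
    1 ≤ overtakes y x w := by
  induction w with
  | nil => simp at hy
  | cons z w ih =>
    by_cases hyw : y ∈ w
    · exact (ih hyw).trans (by simp [overtakes])
    · have hz : z = y := by simpa [hyw, eq_comm] using hy
      simp [overtakes, hz, precedes_of_lt_of_notMem h hyw]

theorem overtakes_cons_of_ne {x z : α} (y : α) (w : List α) (h : z ≠ x) :
    overtakes x y (z :: w) = overtakes x y w := by
  simp [overtakes, h]

end Words

/-! ### Words of thrown balls -/

section Balls

variable {b : ℕ}

/-- The final level of a ball that starts on a given level, for a list of cards. -/
def finalLevel : List (Fin b) → Equiv.Perm (Fin b)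
  | [] => 1
  | c :: l => finalLevel l * cardPerm c

/-- The list of the balls thrown by a list of cards, each named by its final level. -/
def thrown : List (Fin b) → List (Fin b)
  | [] => []
  | c :: l => finalLevel l c :: thrown l

theorem length_thrown (l : List (Fin b)) : (thrown l).length = l.length := by
  induction l with
  | nil => rfl
  | cons c l ih => simp [thrown, ih]

theorem thrown_injective : Function.Injective (thrown (b := b)) := by
  intro l
  induction l with
  | nil =>
    intro l' h
    cases l' with
    | nil => rfl
    | cons c' l' => simp [thrown] at h
  | cons c l ih =>
    intro l' h
    cases l' with
    | nil => simp [thrown] at h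
    | cons c' l' =>
      simp only [thrown, List.cons.injEq] at h
      obtain rfl := ih h.2
      simpa using h.1

theorem cycleRange_val (c i : Fin b) :
    (c.cycleRange i : ℕ) = if i < c then (i : ℕ) + 1 else if i = c then 0 else (i : ℕ) := by
  rcases lt_trichotomy i c with h | h | h
  · simp [h, Fin.coe_cycleRange_of_lt h]
  · subst h
    have := Fin.coe_cycleRange_of_le (le_refl i)
    simp at this
    simp [this]
  · simp [h.not_gt, h.ne', Fin.cycleRange_of_gt h]

theorem cycleRange_lt_cycleRange_iff (c i j : Fin b) :
    c.cycleRange i < c.cycleRange j ↔ i ≠ j ∧ (i = c ∨ (j ≠ c ∧ i < j)) := by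
  rw [Fin.lt_def, cycleRange_val, cycleRange_val]
  simp only [Fin.lt_def, Fin.ext_iff, ne_eq]
  split_ifs <;> omega

/-- The inverse of a card permutation is `Fin.cycleRange`, which brings level `c` to the bottom and
keeps the order of the others: a move to the front. -/
theorem precedes_thrown_iff (x y : Fin b) (l : List (Fin b)) :
    Precedes x y (thrown l) ↔ (finalLevel l)⁻¹ x < (finalLevel l)⁻¹ y := by
  induction l with
  | nil => simp [thrown, Precedes, finalLevel]
  | cons c l ih =>
    have h : ∀ x, (finalLevel (c :: l))⁻¹ x = c.cycleRange ((finalLevel l)⁻¹ x) := by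
      intro x
      simp [finalLevel, mul_inv_rev, cardPerm, Equiv.Perm.inv_def]
    have h' : ∀ x, finalLevel l c = x ↔ (finalLevel l)⁻¹ x = c := by
      intro x
      rw [Equiv.Perm.inv_eq_iff_eq, eq_comm, eq_comm]
    rw [h, h, cycleRange_lt_cycleRange_iff]
    simp only [thrown, Precedes, ih, h', ne_eq, EmbeddingLike.apply_eq_iff_eq]

open Classical in
theorem card_precedes_thrown (c : Fin b) (l : List (Fin b)) :
    (Finset.univ.filter fun y => Precedes y (finalLevel l c) (thrown l)).card = c := by
  simp only [precedes_thrown_iff, Equiv.Perm.inv_def, Equiv.symm_apply_apply]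
  rw [← Fin.card_Iio c]
  refine Finset.card_bij (fun y _ => (finalLevel l)⁻¹ y) (by simp) (by simp) ?_
  intro i hi
  exact ⟨finalLevel l i, by simpa using hi, by simp⟩

theorem sum_cards_eq (l : List (Fin b)) :
    (l.map (Fin.val (n := b))).sum = ∑ x, ∑ y, overtakes x y (thrown l) := by
  classical
  induction l with
  | nil => simp [thrown, overtakes]
  | cons c l ih =>
    simp only [List.map_cons, List.sum_cons, thrown, overtakes, Finset.sum_add_distrib, ih]
    have h : ∑ x, ∑ y, (if finalLevel l c = x ∧ Precedes y x (thrown l) then 1 else 0) =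
        (c : ℕ) := by
      rw [Finset.sum_eq_single (finalLevel l c)]
      · simp [card_precedes_thrown]
      · intro x _ hx
        simp [hx.symm]
      · simp
    rw [h, add_comm]

theorem finalLevel_eq_one_iff (l : List (Fin b)) :
    finalLevel l = 1 ↔ ∀ x y, x < y → Precedes x y (thrown l) := by
  simp only [precedes_thrown_iff]
  constructor
  · intro h x y hxy
    simpa [h] using hxy
  · intro h
    have hm : StrictMono ((finalLevel l)⁻¹ : Equiv.Perm (Fin b)) := fun x y hxy => h x y hxy
    have := hm.eq_id
    rw [← inv_eq_one]
    ext x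
    simp [this]

/-- A card sequence that fixes the order of the balls and uses the highest card throws every ball. -/
theorem mem_thrown_of_top_mem {l : List (Fin b)} (h1 : finalLevel l = 1)
    (ht : ∃ c ∈ l, (c : ℕ) + 1 = b) (x : Fin b) : x ∈ thrown l := by
  obtain ⟨c, hc, hcb⟩ := ht
  have hle : ∀ x : Fin b, x ≤ c := fun x => by rw [Fin.le_def]; omega
  have hcm : c ∈ thrown l := by
    clear h1
    induction l with
    | nil => simp at hc
    | cons d l ih =>
      by_contra hn
      simp only [thrown, List.mem_cons, not_or] at hn
      rcases List.mem_cons.mp hc with rfl | hc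
      -- A ball `c` that is not thrown afterwards is on top right after this card; but the top card
      -- puts the thrown ball there.
      · have h := precedes_of_lt_of_notMem (lt_of_le_of_ne (hle _) (Ne.symm hn.1)) hn.2
        rw [precedes_thrown_iff, Equiv.Perm.inv_def, Equiv.symm_apply_apply] at h
        exact absurd h (hle _).not_gt
      · exact hn.2 (ih hc)
  by_contra hx
  have hlt : x < c := lt_of_le_of_ne (hle x) (fun h => hx (h ▸ hcm))
  exact (not_precedes_iff hlt.ne _).mpr (precedes_of_mem_of_notMem hcm hx)
    ((finalLevel_eq_one_iff l).mp h1 x c hlt)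

/-- After its last throw the ball `c` lies above all others, so that throw reached the top level. -/
theorem top_mem_of_top_mem_thrown {l : List (Fin b)} {c : Fin b} (hcb : (c : ℕ) + 1 = b)
    (hc : c ∈ thrown l) : c ∈ l := by
  have hle : ∀ x : Fin b, x ≤ c := fun x => by rw [Fin.le_def]; omega
  induction l with
  | nil => simp [thrown] at hc
  | cons d l ih =>
    by_cases hcl : c ∈ thrown l
    · exact List.mem_cons_of_mem _ (ih hcl)
    · have hcd : c = finalLevel l d := by simpa [thrown, hcl] using hc
      have hd : d = c := by
        by_contra hd
        have hne : finalLevel l c ≠ c := by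
          rw [hcd]
          intro h
          rw [← hcd] at h
          exact hd ((finalLevel l).injective (hcd.symm.trans h.symm))
        have h := precedes_of_lt_of_notMem (lt_of_le_of_ne (hle _) hne) hcl
        rw [precedes_thrown_iff, Equiv.Perm.inv_def, Equiv.symm_apply_apply, hcd,
          Equiv.symm_apply_apply] at h
        exact absurd (hle d) (by rw [hcd]; exact h.not_ge)
      simp [hd]

theorem sum_overtakes_eq {w : List (Fin b)} (h : ∀ x y, x < y → Precedes x y w) :
    ∑ x, ∑ y, overtakes x y w = 2 * ∑ y, ∑ x ∈ Finset.Iio y, overtakes y x w := by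
  have hs : ∀ x y : Fin b, x < y → overtakes x y w = overtakes y x w := by
    intro x y hxy
    rw [overtakes_swap hxy, if_neg ((not_precedes_iff hxy.ne' w).mpr (h x y hxy)), add_zero]
  have h0 : ∀ x : Fin b, overtakes x x w = 0 := by
    intro x
    clear h hs
    induction w with
    | nil => rfl
    | cons z w ih => simp [overtakes, ih, not_precedes_self]
  have hsplit : ∀ x : Fin b, ∑ y, overtakes x y w =
      ∑ y ∈ Finset.Iio x, overtakes x y w + ∑ y ∈ Finset.Ioi x, overtakes y x w := by
    intro x
    have hI : ∑ y ∈ Finset.Ioi x, overtakes y x w = ∑ y ∈ Finset.Ioi x, overtakes x y w :=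
      Finset.sum_congr rfl fun y hy => (hs x y (Finset.mem_Ioi.mp hy)).symm
    have hd : Disjoint (Finset.Iio x) (Finset.Ioi x) := by
      rw [Finset.disjoint_left]
      intro a ha hb
      exact lt_asymm (Finset.mem_Iio.mp ha) (Finset.mem_Ioi.mp hb)
    rw [hI, ← Finset.sum_union hd]
    symm
    apply Finset.sum_subset (Finset.subset_univ _)
    intro y _ hy
    simp only [Finset.mem_union, Finset.mem_Iio, Finset.mem_Ioi, not_or, not_lt] at hy
    rw [le_antisymm hy.2 hy.1, h0]
  simp only [hsplit, Finset.sum_add_distrib]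
  rw [two_mul]
  congr 1
  exact Finset.sum_comm' (by simp)

theorem two_mul_sum_card_Iio (b : ℕ) :
    2 * ∑ y : Fin b, ∑ _x ∈ Finset.Iio y, 1 = b * (b - 1) := by
  simp only [Finset.sum_const, Fin.card_Iio, smul_eq_mul, mul_one]
  rw [Fin.sum_univ_eq_sum_range (fun i => i) b, mul_comm, Finset.sum_range_id_mul_two]

theorem sum_overtakes_eq_iff {w : List (Fin b)} (h : ∀ x y, x < y → Precedes x y w)
    (hm : ∀ x, x ∈ w) :
    ∑ x, ∑ y, overtakes x y w = b * (b - 1) ↔ ∀ x y, x < y → overtakes y x w = 1 := by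
  rw [sum_overtakes_eq h, ← two_mul_sum_card_Iio]
  have hle : ∀ y : Fin b, ∀ x ∈ Finset.Iio y, 1 ≤ overtakes y x w := fun y x hx =>
    one_le_overtakes (Finset.mem_Iio.mp hx) (hm y)
  rw [Nat.mul_right_inj two_ne_zero, eq_comm,
    Finset.sum_eq_sum_iff_of_le fun y _ => Finset.sum_le_sum (hle y)]
  constructor
  · intro H x y hxy
    exact ((Finset.sum_eq_sum_iff_of_le (hle y)).mp (H y (Finset.mem_univ y)) x
      (Finset.mem_Iio.mpr hxy)).symm
  · intro H y _
    exact Finset.sum_congr rfl fun x hx => (H x y (Finset.mem_Iio.mp hx)).symm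

end Balls

/-! ### Completions of noncrossing words -/

section Noncrossing

variable {b : ℕ}

/-- `w` completes the beginning of a noncrossing word in which the letters below `m` have occurred,
and among them those in `S` may occur again. -/
structure IsCompletion (S : Finset (Fin b)) (m : ℕ) (w : List (Fin b)) : Prop where
  notMem : ∀ x : Fin b, (x : ℕ) < m → x ∉ S → x ∉ w
  mem : ∀ x : Fin b, m ≤ (x : ℕ) → x ∈ w
  overtakes_new : ∀ x y : Fin b, x < y → m ≤ (y : ℕ) → (m ≤ (x : ℕ) ∨ x ∈ S) →
    overtakes y x w = 1
  -- Two available letters `x < y` can only continue as y…y x…x, since `x` closes `y`.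
  overtakes_old : ∀ x y : Fin b, x < y → x ∈ S → y ∈ S → overtakes x y w = 0
  precedes : ∀ x y : Fin b, m ≤ (x : ℕ) → x < y → Precedes x y w

theorem isCompletion_nil_iff {S : Finset (Fin b)} {m : ℕ} (hm : m ≤ b) :
    IsCompletion S m [] ↔ m = b := by
  constructor
  · intro h
    by_contra hne
    have := h.mem ⟨m, by omega⟩ le_rfl
    simp at this
  · rintro rfl
    refine ⟨by simp, fun x hx => ?_, fun x y _ hy => ?_, by simp [overtakes], fun x y hx => ?_⟩ <;>
    omega

theorem isCompletion_cons_new {S : Finset (Fin b)} {z : Fin b} (hS : ∀ s ∈ S, s < z)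
    (w : List (Fin b)) :
    IsCompletion S (z : ℕ) (z :: w) ↔ IsCompletion (insert z S) (z + 1) w := by
  classical
  -- The added `z` passes `x` iff `z` is not yet in front. With `overtakes_swap` the left count is
  -- always `overtakes x z w + 1`.
  have key : ∀ x, x < z → (overtakes z x (z :: w) = 1 ↔ overtakes x z w = 0) := by
    intro x hx
    have h1 := overtakes_swap hx w
    have h2 := not_precedes_iff hx.ne w
    by_cases hp : Precedes x z w
    · have h3 : ¬ Precedes z x w := fun h => h2.mpr h hp
      simp [overtakes, hp, h1, h3]
    · simp [overtakes, hp, h1, h2.mp hp]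
  constructor
  · intro h
    refine ⟨fun x hx hxS => ?_, fun x hx => ?_, fun x y hxy hy hx => ?_, fun x y hxy hx hy => ?_,
      fun x y hx hxy => ?_⟩
    · simp only [Finset.mem_insert, not_or] at hxS
      have hlt : (x : ℕ) < z := by
        have := Fin.val_ne_of_ne hxS.1
        omega
      exact fun hxw => h.notMem x hlt hxS.2 (List.mem_cons_of_mem _ hxw)
    · have hne : x ≠ z := by rintro rfl; omega
      simpa [hne] using h.mem x (by omega)
    · have hne : z ≠ y := by rintro rfl; omega
      rw [← overtakes_cons_of_ne x w hne]
      refine h.overtakes_new x y hxy (by omega) ?_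
      rcases hx with hx | hx
      · exact Or.inl (by omega)
      · rcases Finset.mem_insert.mp hx with rfl | hx
        · exact Or.inl le_rfl
        · exact Or.inr hx
    · rcases Finset.mem_insert.mp hx with rfl | hx
      · rcases Finset.mem_insert.mp hy with rfl | hy
        · exact absurd hxy (lt_irrefl _)
        · exact absurd hxy (hS y hy).not_gt
      · have hxS := hx
        rcases Finset.mem_insert.mp hy with rfl | hy
        · exact (key x hxy).mp (h.overtakes_new x y hxy le_rfl (Or.inr hxS))
        · rw [← overtakes_cons_of_ne y w (hS x hx).ne']
          exact h.overtakes_old x y hxy hx hy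
    · have h' := h.precedes x y (by omega) hxy
      have hne : z ≠ x := by rintro rfl; omega
      simp only [Precedes, hne, false_or] at h'
      exact h'.2.2
  · intro h
    refine ⟨fun x hx hxS => ?_, fun x hx => ?_, fun x y hxy hy hx => ?_, fun x y hxy hx hy => ?_,
      fun x y hx hxy => ?_⟩
    · have hne : x ≠ z := by rintro rfl; omega
      simpa [hne] using h.notMem x (by omega) (by simp [hne, hxS])
    · rcases eq_or_ne x z with rfl | hne
      · simp
      · have := Fin.val_ne_of_ne hne
        exact List.mem_cons_of_mem _ (h.mem x (by omega))
    · rcases eq_or_ne y z with rfl | hne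
      · have hxS : x ∈ S := hx.resolve_left (by rw [Fin.lt_def] at hxy; omega)
        exact (key x hxy).mpr (h.overtakes_old x y hxy (by simp [hxS]) (by simp))
      · have hv := Fin.val_ne_of_ne hne
        rw [overtakes_cons_of_ne x w hne.symm]
        refine h.overtakes_new x y hxy (by omega) ?_
        rcases hx with hx | hx
        · rcases eq_or_ne x z with rfl | hne'
          · exact Or.inr (by simp)
          · have := Fin.val_ne_of_ne hne'
            exact Or.inl (by omega)
        · exact Or.inr (by simp [hx])
    · rw [overtakes_cons_of_ne y w (hS x hx).ne']
      exact h.overtakes_old x y hxy (by simp [hx]) (by simp [hy])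
    · refine ⟨hxy.ne, ?_⟩
      rcases eq_or_ne z x with rfl | hne
      · exact Or.inl rfl
      · have := Fin.val_ne_of_ne hne
        refine Or.inr ⟨?_, h.precedes x y (by omega) hxy⟩
        rintro rfl
        rw [Fin.lt_def] at hxy
        omega

/-- An available `x > z` occurring after this `z` would complete a crossing z x z x, so the letters
above `z` are closed. -/
theorem isCompletion_cons_old {S : Finset (Fin b)} {m : ℕ} (hS : ∀ s ∈ S, (s : ℕ) < m)
    {z : Fin b} (hz : z ∈ S) (w : List (Fin b)) :
    IsCompletion S m (z :: w) ↔ IsCompletion (S.filter (· ≤ z)) m w := by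
  classical
  have hzm := hS z hz
  constructor
  · intro h
    refine ⟨fun x hx hxS hxw => ?_, fun x hx => ?_, fun x y hxy hy hx => ?_,
      fun x y hxy hx hy => ?_, fun x y hx hxy => ?_⟩
    · by_cases hxS' : x ∈ S
      · have hzx : z < x := by simpa [hxS'] using hxS
        have h0 := h.overtakes_old z x hzx hz hxS'
        have h1 := one_le_overtakes hzx hxw
        rw [overtakes_swap hzx] at h1
        simp only [overtakes, true_and] at h0
        omega
      · exact h.notMem x hx hxS' (List.mem_cons_of_mem _ hxw)
    · have hne : x ≠ z := by rintro rfl; omega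
      simpa [hne] using h.mem x hx
    · have hne : z ≠ y := by rintro rfl; omega
      rw [← overtakes_cons_of_ne x w hne]
      exact h.overtakes_new x y hxy hy (hx.imp_right fun hx => (Finset.mem_filter.mp hx).1)
    · rw [Finset.mem_filter] at hx hy
      rw [← overtakes_cons_of_ne y w (hxy.trans_le hy.2).ne']
      exact h.overtakes_old x y hxy hx.1 hy.1
    · have hne : z ≠ x := by rintro rfl; omega
      have h' := h.precedes x y hx hxy
      simp only [Precedes, hne, false_or] at h'
      exact h'.2.2
  · intro h
    have hnot : ∀ x ∈ S, z < x → x ∉ w := fun x hx hzx =>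
      h.notMem x (hS x hx) (by simp [hzx])
    refine ⟨fun x hx hxS => ?_, fun x hx => ?_, fun x y hxy hy hx => ?_,
      fun x y hxy hx hy => ?_, fun x y hx hxy => ?_⟩
    · have hne : x ≠ z := by rintro rfl; exact hxS hz
      simpa [hne] using h.notMem x hx (by simp [hxS])
    · exact List.mem_cons_of_mem _ (h.mem x hx)
    · have hne : z ≠ y := by rintro rfl; omega
      rw [overtakes_cons_of_ne x w hne]
      rcases hx with hx | hx
      · exact h.overtakes_new x y hxy hy (Or.inl hx)
      · rcases le_or_gt x z with hxz | hzx
        · exact h.overtakes_new x y hxy hy (Or.inr (by simp [hx, hxz]))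
        -- A closed letter `x` never moves again, so the new letter `y` passes it exactly once.
        · have hxw := hnot x hx hzx
          rw [overtakes_swap hxy, overtakes_of_notMem y hxw,
            if_pos (precedes_of_mem_of_notMem (h.mem y hy) hxw)]
    · rcases le_or_gt y z with hyz | hzy
      · rw [overtakes_cons_of_ne y w (hxy.trans_le hyz).ne']
        exact h.overtakes_old x y hxy (by simp [hx, (hxy.trans_le hyz).le]) (by simp [hy, hyz])
      · have hyw : y ∉ z :: w := by
          simpa [hzy.ne'] using hnot y hy hzy
        have h1 := overtakes_swap hxy (z :: w)
        rw [overtakes_of_notMem x hyw] at h1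
        omega
    · have hne : z ≠ x := by rintro rfl; omega
      have hne' : z ≠ y := by rintro rfl; rw [Fin.lt_def] at hxy; omega
      exact ⟨hxy.ne, Or.inr ⟨hne', h.precedes x y hx hxy⟩⟩

theorem mem_or_eq_of_isCompletion_cons {S : Finset (Fin b)} {m : ℕ} {z : Fin b}
    {w : List (Fin b)} (h : IsCompletion S m (z :: w)) : z ∈ S ∨ (z : ℕ) = m := by
  by_contra hn
  rw [not_or] at hn
  rcases lt_or_gt_of_ne hn.2 with hz | hz
  · exact h.notMem z hz hn.1 (by simp)
  · have := h.precedes ⟨m, hz.trans z.2⟩ z le_rfl hz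
    simp only [Precedes, ne_eq, not_true_eq_false, false_and, or_false] at this
    exact hz.ne' (congrArg Fin.val this.2)

end Noncrossing

/-! ### Counting -/

section Counting

/-- The number of ways to complete a noncrossing word by `r` letters, where `d` old letters are
available and `k` new letters have to appear. -/
def completionCount : ℕ → ℕ → ℕ → ℕ
  | 0, _, k => if k = 0 then 1 else 0
  | r + 1, d, 0 => ∑ j ∈ Finset.range d, completionCount r (j + 1) 0
  | r + 1, d, k + 1 =>
    completionCount r (d + 1) k + ∑ j ∈ Finset.range d, completionCount r (j + 1) (k + 1)

theorem completionCount_zero_right (r d : ℕ) :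
    completionCount r (d + 1) 0 = (r + d).choose d := by
  induction r generalizing d with
  | zero => simp [completionCount]
  | succ r ih =>
    simp only [completionCount, ih]
    induction d with
    | zero => simp
    | succ d ihd =>
      rw [Finset.sum_range_succ, ihd, show r + 1 + (d + 1) = (r + 1 + d) + 1 by ring,
        Nat.choose_succ_succ, show r + (d + 1) = r + 1 + d by ring]

/-- The formula satisfies the recursion by Pascal's rule. It is stated over the integers because of
the difference. -/
theorem completionCount_succ_right (r d k : ℕ) :
    (completionCount r (d + 1) (k + 1) : ℤ) =
      r.choose (k + 1) * (r + d).choose (d + k + 1) - r.choose k * (r + d).choose (d + k + 2) := by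
  induction r generalizing d k with
  | zero => cases k <;> simp [completionCount, Nat.choose_eq_zero_of_lt]
  | succ r ih =>
    simp only [completionCount]
    push_cast
    simp only [ih]
    -- Both closed forms in one: for `k = 0` the coefficient `r.choose (k - 1)` must be read as 0,
    -- whereas truncated subtraction would make it 1.
    have hnew : ∀ d, (completionCount r (d + 2) k : ℤ) = r.choose k * (r + (d + 1)).choose (d + 1 + k)
        - (if k = 0 then 0 else (r.choose (k - 1) : ℤ)) * (r + (d + 1)).choose (d + k + 2) := by
      intro d
      cases k with
      | zero => simp [completionCount_zero_right]
      | succ k =>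
        rw [ih]
        simp
        ring_nf
    have hpas : ((r + 1).choose k : ℤ) =
        r.choose k + (if k = 0 then 0 else (r.choose (k - 1) : ℤ)) := by
      cases k with
      | zero => simp
      | succ k => rw [Nat.choose_succ_succ]; push_cast; simp; ring
    rw [hpas, Nat.choose_succ_succ r k]
    push_cast
    -- Raising `d` adds one summand, so the sum over old letters is handled by comparing consecutive
    -- `d`.
    induction d with
    | zero =>
      rw [hnew]
      simp only [zero_add, Finset.sum_range_one, add_zero]
      rw [show 1 + k = k + 1 by ring]
      simp only [Nat.choose_succ_succ r, Nat.succ_eq_add_one, show k + 2 = (k + 1) + 1 by ring]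
      push_cast
      ring
    | succ d ihd =>
      rw [Finset.sum_range_succ, ← add_assoc]
      have e := hnew (d + 1)
      have e' := hnew d
      rw [e]
      rw [e'] at ihd
      rw [show r + 1 + d = r + (d + 1) by ring] at ihd
      rw [show r + 1 + (d + 1) = r + (d + 1) + 1 by ring, show r + (d + 1 + 1) = r + (d + 1) + 1 by ring,
        show d + 1 + k + 1 = (d + k + 1) + 1 by ring, show d + 1 + 1 + k = d + k + 1 + 1 by ring,
        show d + 1 + k + 2 = d + k + 2 + 1 by ring]
      rw [show d + 1 + k = d + k + 1 by ring] at ihd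
      simp only [Nat.choose_succ_succ (r + (d + 1)), Nat.succ_eq_add_one]
      push_cast
      simp only [show d + k + 1 + 1 = d + k + 2 by ring]
      linear_combination ihd

theorem completionCount_one_eq (r k : ℕ) :
    (completionCount r 1 k : ℚ) = 1 / ((k : ℚ) + 1) * r.choose k * (r + 1).choose k := by
  cases k with
  | zero => simpa using congrArg (Nat.cast (R := ℚ)) (completionCount_zero_right r 0)
  | succ k =>
    have h : (completionCount r 1 (k + 1) : ℚ) =
        r.choose (k + 1) * r.choose (k + 1) - r.choose k * r.choose (k + 2) := by
      have := completionCount_succ_right r 0 k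
      simp only [zero_add, add_zero] at this
      exact_mod_cast this
    rw [h, Nat.choose_succ_succ r k]
    rcases le_or_gt (k + 1) r with hr | hr
    · have h1 := congrArg (Nat.cast (R := ℚ)) (Nat.choose_succ_right_eq r k)
      have h2 := congrArg (Nat.cast (R := ℚ)) (Nat.choose_succ_right_eq r (k + 1))
      push_cast [Nat.cast_sub hr, Nat.cast_sub (Nat.le_of_succ_le hr)] at h1 h2
      have hk : (k : ℚ) + 1 + 1 ≠ 0 := by positivity
      push_cast
      field_simp
      simp only [show k + 1 + 1 = k + 2 from rfl] at *
      linear_combination (-(r.choose k : ℚ)) * h2 + (r.choose (k + 1) : ℚ) * h1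
    · rw [Nat.choose_eq_zero_of_lt hr, Nat.choose_eq_zero_of_lt (by omega : r < k + 2)]
      simp

/-- The number of elements up to `z` is the rank of `z`, and ranks run once through 1, …, `S.card`.
Hence the choice of an old letter depends on `S` only through its size. -/
theorem sum_filter_le_card {α M : Type*} [LinearOrder α] [AddCommMonoid M] (S : Finset α)
    (f : ℕ → M) :
    ∑ z ∈ S, f (S.filter (· ≤ z)).card = ∑ j ∈ Finset.range S.card, f (j + 1) := by
  induction S using Finset.induction_on_max with
  | empty => simp
  | insert a s ha ih =>
    have hn : a ∉ s := fun h => lt_irrefl a (ha a h)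
    rw [Finset.sum_insert hn, Finset.card_insert_of_notMem hn, Finset.sum_range_succ, ← ih, add_comm]
    congr 1
    · refine Finset.sum_congr rfl fun z hz => ?_
      rw [Finset.filter_insert, if_neg (ha z hz).not_ge]
    · rw [Finset.filter_true_of_mem, Finset.card_insert_of_notMem hn]
      intro x hx
      rcases Finset.mem_insert.mp hx with rfl | hx
      · exact le_rfl
      · exact (ha x hx).le

theorem natCard_vector_succ {α : Type*} [Fintype α] (n : ℕ) (Q : List α → Prop) :
    Nat.card {v : List.Vector α (n + 1) // Q v.toList} =
      ∑ z, Nat.card {v : List.Vector α n // Q (z :: v.toList)} := by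
  rw [← Nat.card_sigma]
  refine Nat.card_congr
    { toFun := fun v => ⟨v.1.head, v.1.tail, ?_⟩
      invFun := fun p => ⟨p.1 ::ᵥ p.2.1, ?_⟩
      left_inv := ?_
      right_inv := ?_ }
  · rw [← List.Vector.toList_cons, List.Vector.cons_head_tail]
    exact v.2
  · rw [List.Vector.toList_cons]
    exact p.2.2
  · intro v
    simp
  · rintro ⟨z, v, hv⟩
    exact Sigma.ext (List.Vector.head_cons z v) (by
      simp only [List.Vector.tail_cons]
      congr!)

theorem natCard_isCompletion {b : ℕ} (n : ℕ) (S : Finset (Fin b)) (m : ℕ) (hm : m ≤ b)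
    (hS : ∀ s ∈ S, (s : ℕ) < m) :
    Nat.card {v : List.Vector (Fin b) n // IsCompletion S m v.toList} =
      completionCount n S.card (b - m) := by
  classical
  induction n generalizing S m with
  | zero =>
    have h : ∀ v : List.Vector (Fin b) 0, IsCompletion S m v.toList ↔ m = b := by
      intro v
      rw [List.Vector.eq_nil v]
      exact isCompletion_nil_iff hm
    simp only [h, completionCount]
    by_cases hb : m = b
    · simp [hb]
    · have : b - m ≠ 0 := by omega
      simp [hb, this]
  | succ n ih =>
    rw [natCard_vector_succ]
    have hold : ∑ z ∈ S, Nat.card {v : List.Vector (Fin b) n // IsCompletion S m (z :: v.toList)} =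
        ∑ j ∈ Finset.range S.card, completionCount n (j + 1) (b - m) := by
      rw [← sum_filter_le_card S fun d => completionCount n d (b - m)]
      refine Finset.sum_congr rfl fun z hz => ?_
      simp only [isCompletion_cons_old hS hz]
      exact ih _ m hm fun s hs => hS s (Finset.mem_filter.mp hs).1
    have hzero : ∀ z, z ∉ S → (z : ℕ) ≠ m →
        Nat.card {v : List.Vector (Fin b) n // IsCompletion S m (z :: v.toList)} = 0 := by
      intro z hz hzm
      have : IsEmpty {v : List.Vector (Fin b) n // IsCompletion S m (z :: v.toList)} :=
        ⟨fun v => (mem_or_eq_of_isCompletion_cons v.2).elim hz hzm⟩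
      exact Nat.card_of_isEmpty
    rcases hm.eq_or_lt with rfl | hlt
    · rw [Nat.sub_self] at hold ⊢
      rw [completionCount, ← hold]
      symm
      exact Finset.sum_subset (Finset.subset_univ S) fun z _ hz => hzero z hz (by omega)
    · have hmS : (⟨m, hlt⟩ : Fin b) ∉ S := fun h => lt_irrefl _ (hS _ h)
      obtain ⟨k, hk⟩ : ∃ k, b - m = k + 1 := ⟨b - m - 1, by omega⟩
      rw [hk] at hold ⊢
      rw [completionCount, ← hold,
        ← Finset.sum_subset (Finset.subset_univ (insert ⟨m, hlt⟩ S)), Finset.sum_insert hmS]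
      · congr 1
        have hS' : ∀ s ∈ S, s < (⟨m, hlt⟩ : Fin b) := fun s hs => hS s hs
        have h1 : ∀ w, IsCompletion S m (⟨m, hlt⟩ :: w) ↔
            IsCompletion (insert ⟨m, hlt⟩ S) (m + 1) w := isCompletion_cons_new hS'
        simp only [h1]
        rw [ih _ (m + 1) hlt, Finset.card_insert_of_notMem hmS, show b - (m + 1) = k by omega]
        intro s hs
        rcases Finset.mem_insert.mp hs with rfl | hs
        · exact Nat.lt_succ_self m
        · exact (hS s hs).trans (Nat.lt_succ_self m)
      · intro z _ hz
        simp only [Finset.mem_insert, not_or, Fin.ext_iff] at hz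
        exact hzero z hz.2 hz.1

/-- Passing from cards to thrown balls is a bijection. -/
theorem natCard_thrown {b : ℕ} (n : ℕ) (Q : List (Fin b) → Prop) :
    Nat.card {v : List.Vector (Fin b) n // Q (thrown v.toList)} =
      Nat.card {v : List.Vector (Fin b) n // Q v.toList} := by
  let f : List.Vector (Fin b) n → List.Vector (Fin b) n := fun v =>
    ⟨thrown v.toList, by rw [length_thrown, List.Vector.toList_length]⟩
  have hf : Function.Injective f := fun v v' h =>
    List.Vector.toList_injective (thrown_injective (congrArg List.Vector.toList h))
  exact Nat.card_congr
    ((Equiv.ofBijective f (Finite.injective_iff_bijective.mp hf)).subtypeEquiv fun _ => Iff.rfl)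

end Counting

/-! ### Minimal crossing sequences as noncrossing words, and the final count -/

variable {b n : ℕ}

theorem perm_eq_finalLevel (A : JugglingCardSequence b n) : A.perm = finalLevel (List.ofFn A) := by
  have h : ∀ l : List (Fin b), (l.map cardPerm).reverse.prod = finalLevel l := by
    intro l
    induction l with
    | nil => rfl
    | cons c l ih => simp [finalLevel, ih]
  rw [perm, ← h, List.map_ofFn]
  rfl

theorem isMinimalCrossing_iff (hb : 1 ≤ b) (A : JugglingCardSequence b n) :
    A.IsMinimalCrossing ↔ IsCompletion ∅ 0 (thrown (List.ofFn A)) := by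
  have hcr : A.crossings = ∑ x, ∑ y, overtakes x y (thrown (List.ofFn A)) := by
    rw [← sum_cards_eq, List.map_ofFn, List.sum_ofFn]
    rfl
  have huse : A.UsesCard b ↔ ∃ c ∈ List.ofFn A, (c : ℕ) + 1 = b := by
    simp [UsesCard, List.mem_ofFn]
  constructor
  · rintro ⟨h1, h2, h3⟩
    rw [perm_eq_finalLevel] at h2
    have hm := mem_thrown_of_top_mem h2 (huse.mp h1)
    have hp := (finalLevel_eq_one_iff _).mp h2
    rw [hcr, sum_overtakes_eq_iff hp hm] at h3
    exact ⟨by simp, fun x _ => hm x, fun x y hxy _ _ => h3 x y hxy, by simp,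
      fun x y _ hxy => hp x y hxy⟩
  · intro h
    have hp : ∀ x y, x < y → Precedes x y (thrown (List.ofFn A)) := fun x y =>
      h.precedes x y (Nat.zero_le _)
    have hm : ∀ x, x ∈ thrown (List.ofFn A) := fun x => h.mem x (Nat.zero_le _)
    refine ⟨huse.mpr ⟨⟨b - 1, by omega⟩, top_mem_of_top_mem_thrown ?_ (hm _), ?_⟩, ?_, ?_⟩
    · exact Nat.sub_add_cancel hb
    · exact Nat.sub_add_cancel hb
    · rw [perm_eq_finalLevel]
      exact (finalLevel_eq_one_iff _).mpr hp
    · rw [hcr, sum_overtakes_eq_iff hp hm]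
      exact fun x y hxy => h.overtakes_new x y hxy (Nat.zero_le _) (Or.inl (Nat.zero_le _))

theorem natCard_isMinimalCrossing (hb : 1 ≤ b) :
    Nat.card {A : JugglingCardSequence b n // A.IsMinimalCrossing} = completionCount n 0 b := by
  have h := natCard_isCompletion (b := b) n ∅ 0 (Nat.zero_le b) (by simp)
  rw [Finset.card_empty, Nat.sub_zero] at h
  rw [← h, ← natCard_thrown n (IsCompletion ∅ 0)]
  refine Nat.card_congr ((Equiv.vectorEquivFin (Fin b) n).symm.subtypeEquiv fun A => ?_)
  rw [isMinimalCrossing_iff hb]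
  have : ((Equiv.vectorEquivFin (Fin b) n).symm A).toList = List.ofFn A :=
    List.Vector.toList_ofFn A
  rw [this]

end JugglingCardSequence

theorem mainTheorem5 (b n : ℕ) (hb : 1 ≤ b) (hn : 1 ≤ n) :
    (Nat.card {A : JugglingCardSequence b n // A.IsMinimalCrossing} : ℚ) =
        1 / (b : ℚ) * ((n - 1).choose (b - 1) : ℚ) * (n.choose (b - 1) : ℚ) ∧
      (Nat.card {A : JugglingCardSequence b n // A.IsMinimalCrossing} : ℚ) =
        1 / (n : ℚ) * (n.choose b : ℚ) * (n.choose (b - 1) : ℚ) := by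
  obtain ⟨b, rfl⟩ := Nat.exists_eq_add_of_le' hb
  obtain ⟨n, rfl⟩ := Nat.exists_eq_add_of_le' hn
  have h : (Nat.card {A : JugglingCardSequence (b + 1) (n + 1) // A.IsMinimalCrossing} : ℚ) =
      1 / ((b : ℚ) + 1) * n.choose b * (n + 1).choose b := by
    rw [JugglingCardSequence.natCard_isMinimalCrossing hb,
      ← JugglingCardSequence.completionCount_one_eq]
    -- With no open letter the first letter must be new, which leaves one open letter, `b` new ones
    -- and `n` positions.
    simp [JugglingCardSequence.completionCount]
  rw [h]
  have hc := congrArg (Nat.cast (R := ℚ)) (Nat.add_one_mul_choose_eq n b)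
  push_cast at hc
  have hb0 : (b : ℚ) + 1 ≠ 0 := by positivity
  have hn0 : (n : ℚ) + 1 ≠ 0 := by positivity
  refine ⟨by simp, ?_⟩
  simp only [Nat.add_sub_cancel]
  push_cast
  field_simp
  linear_combination ((n + 1).choose b : ℚ) * hc
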